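/- Let $s>2$ be an integer, let $p_0,\dots,p_{s-1}>0$ be real numbers with $p_0+\dots+p_{s-1}=1$, and put $\beta_k=\sum_{i<k}p_i$ for $0\le k\le s-1$ (so $\beta_0=0$). For a sequence of digits $d_1,d_2,\dots\in\{0,\dots,s-1\}$ let $$\Delta^P_{d_1d_2\dots}=\beta_{d_1}+\sum_{n=2}^{\infty}\Big(\beta_{d_n}\prod_{j=1}^{n-1}p_{d_j}\Big)\in[0,1].$$ Fix $u\in\{0,\dots,s-1\}$, let $A_0=\{1,\dots,s-1\}$, and let $$\mathbb S_{(P_s,u)}=\Big\{\Delta^{P}_{\underbrace{u\dots u}_{\alpha_1-1}\alpha_1\underbrace{u\dots u}_{\alpha_2-1}\alpha_2\dots\underbrace{u\dots u}_{\alpha_n-1}\alpha_n\dots}\;:\;\alpha_n\in A_0\setminus\{u\}\text{ for all }n\ge 1\Big\}.$$ Then: (1) $\mathbb S_{(P_s,u)}$ is a self-similar set with ratios $p_ip_u^{i-1}$, $i\in A_0\setminus\{u\}$: it is nonempty and compact, all these ratios lie in $(0,1)$, and there are maps $f_i:\mathbb R\to\mathbb R$ with $|f_i(x)-f_i(y)|=p_ip_u^{i-1}|x-y|$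 for all $x,y\in\mathbb R$ such that $\mathbb S_{(P_s,u)}$ is the union of the pairwise disjoint sets $f_i(\mathbb S_{(P_s,u)})$, $i\in A_0\setminus\{u\}$. (2) If $(s,u)\notin\{(3,1),(3,2)\}$, then $\mathbb S_{(P_s,u)}$ is a fractal, i.e. its Hausdorff dimension exceeds its topological dimension: it is totally disconnected and has positive Hausdorff dimension. (3) The Hausdorff dimension $\alpha_0$ of $\mathbb S_{(P_s,u)}$ is finite and is the unique real root of the equation $$\sum_{i\in A_0\setminus\{u\}}\left(p_ip_u^{i-1}\right)^{\alpha_0}=1.$$ -/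

import Mathlib

/-- The partial sums `β_k = p_0 + ⋯ + p_{k-1}` of the weights (so `β_0 = 0`). -/
noncomputable def pBeta {s : ℕ} (p : Fin s → ℝ) (k : Fin s) : ℝ :=
  ∑ i ∈ Finset.Iio k, p i

/-- `IsPRepresentation p d x` says that `d 0, d 1, d 2, …` is a P-representation of `x`, i.e.
`x = β_{d 0} + ∑_{n ≥ 1} β_{d n} p_{d 0} ⋯ p_{d (n-1)}`, the series being convergent
(digit positions are counted from `0`). -/
def IsPRepresentation {s : ℕ} (p : Fin s → ℝ) (d : ℕ → Fin s) (x : ℝ) : Prop :=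
  HasSum (fun n : ℕ => pBeta p (d n) * ∏ j ∈ Finset.range n, p (d j)) x

/-- The set `A_0 ∖ {u}` of digits different from `0` and from `u`. -/
def admissibleDigits {s : ℕ} (u : Fin s) : Finset (Fin s) :=
  Finset.univ.filter (fun i => (i : ℕ) ≠ 0 ∧ i ≠ u)

/-- The position (counted from `0`) at which the `n`-th block starts, when the `k`-th block has
length `a k`. -/
def blockStart {s : ℕ} (a : ℕ → Fin s) (n : ℕ) : ℕ :=
  ∑ k ∈ Finset.range n, (a k : ℕ)

/-- `d` is the concatenation of the blocks `u … u (a n)`, `n = 0, 1, 2, …`, the `n`-th block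
consisting of `a n - 1` copies of `u` followed by the digit `a n`. If all `a n` are nonzero, this
determines every digit of `d`. -/
def IsBlockSequence {s : ℕ} (u : Fin s) (a d : ℕ → Fin s) : Prop :=
  ∀ n : ℕ, (∀ j : ℕ, j < (a n : ℕ) - 1 → d (blockStart a n + j) = u) ∧
    d (blockStart a n + ((a n : ℕ) - 1)) = a n

/-- The set `𝕊_(P_s,u)`. -/
def setS {s : ℕ} (p : Fin s → ℝ) (u : Fin s) : Set ℝ :=
  {x | ∃ a d : ℕ → Fin s, (∀ n, a n ∈ admissibleDigits u) ∧ IsBlockSequence u a d ∧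
    IsPRepresentation p d x}

/-- `S` is a self-similar set with similarity ratios `r i`, `i : ι` (`ι` finite): it is nonempty
and compact, and it is the disjoint union of its images under contracting similarities with
these ratios. -/
def IsSelfSimilarSet {X ι : Type*} [MetricSpace X] [Finite ι] (r : ι → ℝ) (S : Set X) : Prop :=
  S.Nonempty ∧ IsCompact S ∧ (∀ i, 0 < r i ∧ r i < 1) ∧
    ∃ f : ι → X → X,
      (∀ i x y, dist (f i x) (f i y) = r i * dist x y) ∧
      S = ⋃ i, f i '' S ∧
      Pairwise (fun i j => Disjoint (f i '' S) (f j '' S))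

/-- A set of real numbers is a fractal if its Hausdorff dimension exceeds its topological
dimension. A subset of the line has topological dimension at most `0` exactly when it is totally
disconnected; otherwise it contains an interval and both dimensions are `1`. -/
def IsFractalSubset (S : Set ℝ) : Prop :=
  IsTotallyDisconnected S ∧ 0 < dimH S

/-! The set `𝕊_(P_s,u)` is the attractor of the affine maps `blockMap p u i` which prepend a block
`u … u i`, and the blocks can be recovered from a point because the images of `(0, 1]` under these
maps are disjoint. For a self-similar set with ratios `r_i`, let `α` be the exponent with
`∑ r_i ^ α = 1`. The cylinders of order `n` cover the set and their diameters to the power `α` have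
bounded sum, so its dimension is at most `α`. For the lower bound, `w_i = r_i ^ α` is a probability
vector, hence the P-representation with weights `w` codes `[0, 1]`; sending a point of the
self-similar set to the number with the same address is `α`-Hölder, because the first-level pieces
are at positive distance from each other, and it maps onto `[0, 1]`. -/

section CodingMap

open Set Filter Topology MeasureTheory Metric
open scoped NNReal ENNReal

variable {ι X Y : Type*}

section Orbits

variable [PseudoEMetricSpace X] {f : ι → X → X} {r : ι → ℝ≥0} {a : ℕ → ι} {x y : ℕ → X} {n : ℕ}

theorem edist_le_prod_mul_edist (hf : ∀ i, LipschitzWith (r i) (f i))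
    (hx : ∀ j < n, x j = f (a j) (x (j + 1))) (hy : ∀ j < n, y j = f (a j) (y (j + 1))) :
    edist (x 0) (y 0) ≤ ↑(∏ j ∈ Finset.range n, r (a j)) * edist (x n) (y n) := by
  induction n with
  | zero => simp
  | succ n ih =>
    calc edist (x 0) (y 0)
        ≤ ↑(∏ j ∈ Finset.range n, r (a j)) * edist (x n) (y n) :=
          ih (fun j hj => hx j (hj.trans n.lt_succ_self)) fun j hj => hy j (hj.trans n.lt_succ_self)
      _ ≤ ↑(∏ j ∈ Finset.range n, r (a j)) * (r (a n) * edist (x (n + 1)) (y (n + 1))) := by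
          rw [hx n n.lt_succ_self, hy n n.lt_succ_self]
          gcongr
          exact hf _ _ _
      _ = ↑(∏ j ∈ Finset.range (n + 1), r (a j)) * edist (x (n + 1)) (y (n + 1)) := by
          rw [Finset.prod_range_succ, ENNReal.coe_mul, mul_assoc]

theorem prod_mul_edist_le_edist (hf : ∀ i x y, r i * edist x y ≤ edist (f i x) (f i y))
    (hx : ∀ j < n, x j = f (a j) (x (j + 1))) (hy : ∀ j < n, y j = f (a j) (y (j + 1))) :
    ↑(∏ j ∈ Finset.range n, r (a j)) * edist (x n) (y n) ≤ edist (x 0) (y 0) := by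
  induction n with
  | zero => simp
  | succ n ih =>
    calc ↑(∏ j ∈ Finset.range (n + 1), r (a j)) * edist (x (n + 1)) (y (n + 1))
        = ↑(∏ j ∈ Finset.range n, r (a j)) * (r (a n) * edist (x (n + 1)) (y (n + 1))) := by
          rw [Finset.prod_range_succ, ENNReal.coe_mul, mul_assoc]
      _ ≤ ↑(∏ j ∈ Finset.range n, r (a j)) * edist (x n) (y n) := by
          rw [hx n n.lt_succ_self, hy n n.lt_succ_self]
          gcongr
          exact hf _ _ _
      _ ≤ edist (x 0) (y 0) :=
          ih (fun j hj => hx j (hj.trans n.lt_succ_self)) fun j hj => hy j (hj.trans n.lt_succ_self)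

end Orbits

theorem tendsto_pow_mul_zero {ρ : ℝ≥0} {D : ℝ≥0∞} (hρ : ρ < 1) (hD : D ≠ ∞) :
    Tendsto (fun n => (ρ : ℝ≥0∞) ^ n * D) atTop (𝓝 0) := by
  simpa using ENNReal.Tendsto.mul_const
    (ENNReal.tendsto_pow_atTop_nhds_zero_of_lt_one (ENNReal.coe_lt_one_iff.2 hρ)) (.inr hD)

theorem exists_lipschitzWith_lt_one [Finite ι] [PseudoMetricSpace X] {f : ι → X → X} {r : ι → ℝ}
    (hr : ∀ i, r i < 1) (hf : ∀ i x y, dist (f i x) (f i y) ≤ r i * dist x y) :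
    ∃ ρ : ℝ≥0, ρ < 1 ∧ ∀ i, LipschitzWith ρ (f i) := by
  cases isEmpty_or_nonempty ι
  · exact ⟨0, one_pos, isEmptyElim⟩
  · obtain ⟨i, hi⟩ := Finite.exists_max r
    refine ⟨(r i).toNNReal, Real.toNNReal_lt_one.2 (hr i), fun j =>
      LipschitzWith.of_dist_le' fun x y => (hf j x y).trans ?_⟩
    gcongr
    exact hi j

/-- `π` is the coding map of the iterated function system `f`: the point `π a` has the address `a`,
i.e. it is the limit of `f (a 0) ∘ ⋯ ∘ f (a n)` at any base point. This is encoded by a functional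
equation, whose bounded solution is unique when the maps are uniform contractions. -/
structure IsCodingMap [PseudoMetricSpace X] (f : ι → X → X) (π : (ℕ → ι) → X) : Prop where
  isBounded_range : Bornology.IsBounded (range π)
  apply_eq : ∀ a, π a = f (a 0) (π fun n => a (n + 1))

namespace IsCodingMap

section PseudoMetricSpace

variable [PseudoMetricSpace X] {f : ι → X → X} {π : (ℕ → ι) → X} {r : ι → ℝ≥0} {ρ : ℝ≥0}

theorem apply_shift (hπ : IsCodingMap f π) (a : ℕ → ι) (n : ℕ) :
    π (fun k => a (k + n)) = f (a n) (π fun k => a (k + (n + 1))) := by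
  have := hπ.apply_eq fun k => a (k + n)
  simpa only [zero_add, add_assoc, add_comm 1 n] using this

theorem apply_eq_iterate (hπ : IsCodingMap f π) {a : ℕ → ι} {i : ι} {n : ℕ}
    (ha : ∀ j < n, a j = i) : π a = (f i)^[n] (π fun k => a (k + n)) := by
  induction n with
  | zero => rfl
  | succ n ih =>
    rw [ih fun j hj => ha j (hj.trans n.lt_succ_self), hπ.apply_shift, ha n n.lt_succ_self,
      Function.iterate_succ_apply]

theorem range_eq_iUnion (hπ : IsCodingMap f π) : range π = ⋃ i, f i '' range π := by
  refine Subset.antisymm ?_ (iUnion_subset fun i => ?_)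
  · rintro _ ⟨a, rfl⟩
    exact mem_iUnion.2 ⟨a 0, _, mem_range_self _, (hπ.apply_eq a).symm⟩
  · rintro _ ⟨_, ⟨a, rfl⟩, rfl⟩
    exact ⟨fun n => Nat.casesOn n i a, hπ.apply_eq _⟩

theorem edist_le (hπ : IsCodingMap f π) (hf : ∀ i, LipschitzWith (r i) (f i)) {n : ℕ}
    {a b : ℕ → ι} (hab : ∀ j < n, a j = b j) :
    edist (π a) (π b) ≤ ↑(∏ j ∈ Finset.range n, r (a j)) * ediam (range π) :=
  calc edist (π a) (π b)
      ≤ ↑(∏ j ∈ Finset.range n, r (a j)) *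
          edist (π fun k => a (k + n)) (π fun k => b (k + n)) :=
        edist_le_prod_mul_edist (x := fun n => π fun k => a (k + n))
          (y := fun n => π fun k => b (k + n)) hf (fun j _ => hπ.apply_shift a j)
          fun j hj => by rw [hab j hj]; exact hπ.apply_shift b j
    _ ≤ ↑(∏ j ∈ Finset.range n, r (a j)) * ediam (range π) := by
        gcongr
        exact edist_le_ediam_of_mem (mem_range_self _) (mem_range_self _)

theorem prod_mul_edist_le (hπ : IsCodingMap f π)
    (hf : ∀ i x y, r i * edist x y ≤ edist (f i x) (f i y)) {n : ℕ}
    {a b : ℕ → ι} (hab : ∀ j < n, a j = b j) :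
    ↑(∏ j ∈ Finset.range n, r (a j)) * edist (π fun k => a (k + n)) (π fun k => b (k + n))
      ≤ edist (π a) (π b) :=
  prod_mul_edist_le_edist (x := fun n => π fun k => a (k + n))
    (y := fun n => π fun k => b (k + n)) hf (fun j _ => hπ.apply_shift a j)
    fun j hj => by rw [hab j hj]; exact hπ.apply_shift b j

theorem continuous [TopologicalSpace ι] [DiscreteTopology ι] (hπ : IsCodingMap f π)
    (hf : ∀ i, LipschitzWith ρ (f i)) (hρ : ρ < 1) : Continuous π := by
  have hlim := tendsto_pow_mul_zero hρ hπ.isBounded_range.ediam_ne_top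
  refine continuous_iff_continuousAt.2 fun a => EMetric.tendsto_nhds.2 fun ε hε => ?_
  obtain ⟨n, hn⟩ := (hlim.eventually_lt_const hε).exists
  have hagree : ∀ᶠ b in 𝓝 a, ∀ j ∈ Iio n, b j = a j :=
    (finite_Iio n).eventually_all.2 fun j _ =>
      (continuous_apply j).tendsto a ((isOpen_discrete {a j}).mem_nhds rfl)
  filter_upwards [hagree] with b hb
  exact (hπ.edist_le hf hb).trans_lt (by simpa using hn)

end PseudoMetricSpace

section MetricSpace

variable [MetricSpace X] {f : ι → X → X} {π : (ℕ → ι) → X} {ρ : ℝ≥0}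

theorem apply_eq_of_orbit (hπ : IsCodingMap f π) (hf : ∀ i, LipschitzWith ρ (f i)) (hρ : ρ < 1)
    {K : Set X} (hK : Bornology.IsBounded K) {a : ℕ → ι} {y : ℕ → X} (hyK : ∀ n, y n ∈ K)
    (hy : ∀ n, y n = f (a n) (y (n + 1))) : π a = y 0 := by
  have hle (n : ℕ) : edist (π a) (y 0) ≤ (ρ : ℝ≥0∞) ^ n * ediam (range π ∪ K) :=
    calc edist (π a) (y 0)
        ≤ ↑(∏ _j ∈ Finset.range n, ρ) * edist (π fun k => a (k + n)) (y n) :=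
          edist_le_prod_mul_edist (x := fun n => π fun k => a (k + n)) hf
            (fun j _ => hπ.apply_shift a j) fun j _ => hy j
      _ ≤ (ρ : ℝ≥0∞) ^ n * ediam (range π ∪ K) := by
          rw [Finset.prod_const, Finset.card_range, ENNReal.coe_pow]
          gcongr
          exact edist_le_ediam_of_mem (.inl (mem_range_self _)) (.inr (hyK n))
  exact edist_le_zero.1 <| ge_of_tendsto'
    (tendsto_pow_mul_zero hρ (hπ.isBounded_range.union hK).ediam_ne_top) hle

theorem subset_range (hπ : IsCodingMap f π) (hf : ∀ i, LipschitzWith ρ (f i)) (hρ : ρ < 1)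
    {K : Set X} (hK : Bornology.IsBounded K) (hsub : K ⊆ ⋃ i, f i '' K) : K ⊆ range π := by
  have hstep (x : K) : ∃ (i : ι) (y : K), (x : X) = f i y := by
    obtain ⟨i, y, hy, hxy⟩ := mem_iUnion.1 (hsub x.2)
    exact ⟨i, ⟨y, hy⟩, hxy.symm⟩
  choose digit next hnext using hstep
  intro x hx
  refine ⟨fun n => digit (next^[n] ⟨x, hx⟩), hπ.apply_eq_of_orbit hf hρ hK
    (y := fun n => next^[n] ⟨x, hx⟩) (fun n => Subtype.coe_prop _) fun n => ?_⟩
  rw [Function.iterate_succ_apply']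
  exact hnext _

theorem isSelfSimilarSet_range [Finite ι] [Nonempty ι] {r : ι → ℝ} (hπ : IsCodingMap f π)
    (hr₀ : ∀ i, 0 < r i) (hr₁ : ∀ i, r i < 1)
    (hf : ∀ i x y, dist (f i x) (f i y) = r i * dist x y)
    (hdisj : Pairwise fun i j => Disjoint (f i '' range π) (f j '' range π)) :
    IsSelfSimilarSet r (range π) := by
  let _ : TopologicalSpace ι := ⊥
  have : DiscreteTopology ι := ⟨rfl⟩
  obtain ⟨ρ, hρ, hfρ⟩ := exists_lipschitzWith_lt_one hr₁ fun i x y => (hf i x y).le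
  exact ⟨range_nonempty π, isCompact_range (hπ.continuous hfρ hρ), fun i => ⟨hr₀ i, hr₁ i⟩,
    f, hf, hπ.range_eq_iUnion, hdisj⟩

end MetricSpace

end IsCodingMap

/-- The coding map is the fixed point of `g ↦ (a ↦ f (a 0) (g (a 1, a 2, …)))`, a contraction of the
space of continuous maps from the compact space of addresses. -/
theorem exists_isCodingMap_of_lipschitzWith [MetricSpace X] [CompleteSpace X] [Nonempty X]
    [Finite ι] {f : ι → X → X} {ρ : ℝ≥0} (hf : ∀ i, LipschitzWith ρ (f i)) (hρ : ρ < 1) :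
    ∃ π : (ℕ → ι) → X, IsCodingMap f π := by
  let _ : TopologicalSpace ι := ⊥
  have : DiscreteTopology ι := ⟨rfl⟩
  let Φ (g : C(ℕ → ι, X)) : C(ℕ → ι, X) :=
    { toFun a := f (a 0) (g fun n => a (n + 1))
      continuous_toFun := (continuous_prod_of_discrete_left.2 fun i => (hf i).continuous).comp
        (g := fun q : ι × X => f q.1 q.2)
        (by fun_prop : Continuous fun a : ℕ → ι => (a 0, g fun n => a (n + 1))) }
  have hΦ : ContractingWith ρ Φ := by
    refine ⟨hρ, LipschitzWith.of_dist_le_mul fun g h => ?_⟩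
    refine (ContinuousMap.dist_le (by positivity)).2 fun a => ((hf _).dist_le_mul _ _).trans ?_
    gcongr
    exact ContinuousMap.dist_apply_le_dist _
  have : Nonempty C(ℕ → ι, X) := ⟨.const _ (Classical.arbitrary X)⟩
  refine ⟨hΦ.fixedPoint, (isCompact_range (map_continuous hΦ.fixedPoint)).isBounded, fun a => ?_⟩
  exact (DFunLike.congr_fun hΦ.fixedPoint_isFixedPt a).symm

theorem IsSelfSimilarSet.exists_isCodingMap [MetricSpace X] [Finite ι] {r : ι → ℝ} {S : Set X}
    (hS : IsSelfSimilarSet r S) : ∃ (f : ι → X → X) (π : (ℕ → ι) → X),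
      (∀ i x y, dist (f i x) (f i y) = r i * dist x y) ∧ IsCodingMap f π ∧ range π = S ∧
      Pairwise fun i j => Disjoint (f i '' S) (f j '' S) := by
  obtain ⟨hne, hcpt, hr, f, hf, hSf, hdisj⟩ := hS
  obtain ⟨ρ, hρ, hfρ⟩ := exists_lipschitzWith_lt_one (fun i => (hr i).2) fun i x y => (hf i x y).le
  have hmaps (i : ι) : MapsTo (f i) S S := fun x hx => by
    rw [hSf]
    exact mem_iUnion.2 ⟨i, mem_image_of_mem _ hx⟩
  have : CompleteSpace S := hcpt.isComplete.completeSpace_coe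
  have : Nonempty S := hne.to_subtype
  obtain ⟨π, hπ⟩ := exists_isCodingMap_of_lipschitzWith
    (f := fun i => (hmaps i).restrict)
    (fun i => (hfρ i).lipschitzOnWith.mapsToRestrict (hmaps i)) hρ
  have hπ' : IsCodingMap f fun a => (π a : X) :=
    ⟨hcpt.isBounded.subset (range_subset_iff.2 fun a => (π a).2),
      fun a => congrArg Subtype.val (hπ.apply_eq a)⟩
  exact ⟨f, _, hf, hπ', (range_subset_iff.2 fun a => (π a).2).antisymm
    (hπ'.subset_range hfρ hρ hcpt.isBounded hSf.subset), hdisj⟩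

namespace IsCodingMap

section UpperBound

variable {f : ι → X → X} {π : (ℕ → ι) → X} {r : ι → ℝ≥0}

theorem ediam_cylinder_le [PseudoMetricSpace X] (hπ : IsCodingMap f π)
    (hf : ∀ i, LipschitzWith (r i) (f i)) {n : ℕ} (w : Fin n → ι) :
    ediam (π '' {a | ∀ j : Fin n, a j = w j}) ≤ ↑(∏ j, r (w j)) * ediam (range π) := by
  refine ediam_le ?_
  rintro _ ⟨a, ha, rfl⟩ _ ⟨b, hb, rfl⟩
  have hprod : ∏ j, r (w j) = ∏ j ∈ Finset.range n, r (a j) := by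
    simp only [Finset.prod_range, ha _]
  rw [hprod]
  exact hπ.edist_le hf fun j hj => (ha ⟨j, hj⟩).trans (hb ⟨j, hj⟩).symm

theorem sum_ediam_cylinder_rpow_le [Fintype ι] [PseudoMetricSpace X] (hπ : IsCodingMap f π)
    (hf : ∀ i, LipschitzWith (r i) (f i)) {α : ℝ≥0} (hα : ∑ i, r i ^ (α : ℝ) ≤ 1) (n : ℕ) :
    ∑ w : Fin n → ι, ediam (π '' {a | ∀ j : Fin n, a j = w j}) ^ (α : ℝ)
      ≤ ediam (range π) ^ (α : ℝ) :=
  calc ∑ w : Fin n → ι, ediam (π '' {a | ∀ j : Fin n, a j = w j}) ^ (α : ℝ)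
      ≤ ∑ w : Fin n → ι, ↑(∏ j, r (w j) ^ (α : ℝ)) * ediam (range π) ^ (α : ℝ) := by
        refine Finset.sum_le_sum fun w _ => ?_
        rw [NNReal.finsetProd_rpow, ENNReal.coe_rpow_of_nonneg _ α.coe_nonneg,
          ← ENNReal.mul_rpow_of_nonneg _ _ α.coe_nonneg]
        exact ENNReal.rpow_le_rpow (hπ.ediam_cylinder_le hf w) α.coe_nonneg
    _ = ↑((∑ i, r i ^ (α : ℝ)) ^ n) * ediam (range π) ^ (α : ℝ) := by
        rw [← Finset.sum_mul, Fintype.sum_pow, ENNReal.ofNNReal_finsetSum]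
    _ ≤ ediam (range π) ^ (α : ℝ) :=
        mul_le_of_le_one_left' (ENNReal.coe_le_one_iff.2 (pow_le_one' hα n))

variable [Fintype ι] [MetricSpace X]

theorem hausdorffMeasure_range_le [MeasurableSpace X] [BorelSpace X] (hπ : IsCodingMap f π)
    (hf : ∀ i, LipschitzWith (r i) (f i)) (hr : ∀ i, r i < 1) {α : ℝ≥0}
    (hα : ∑ i, r i ^ (α : ℝ) ≤ 1) : μH[α] (range π) ≤ ediam (range π) ^ (α : ℝ) := by
  obtain ⟨ρ, hρ, hfρ⟩ := exists_lipschitzWith_lt_one (r := fun i => r i) hr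
    fun i => (hf i).dist_le_mul
  have hmesh (n : ℕ) (w : Fin n → ι) :
      ediam (π '' {a | ∀ j : Fin n, a j = w j}) ≤ (ρ : ℝ≥0∞) ^ n * ediam (range π) := by
    simpa using hπ.ediam_cylinder_le hfρ w
  have hcover (n : ℕ) : range π ⊆ ⋃ w : Fin n → ι, π '' {a | ∀ j : Fin n, a j = w j} :=
    range_subset_iff.2 fun a => mem_iUnion.2 ⟨fun j => a j, a, fun _ => rfl, rfl⟩
  calc μH[α] (range π)
      ≤ liminf (fun n => ∑ w : Fin n → ι,
          ediam (π '' {a | ∀ j : Fin n, a j = w j}) ^ (α : ℝ)) atTop :=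
        Measure.hausdorffMeasure_le_liminf_sum _ _ _
          (tendsto_pow_mul_zero hρ hπ.isBounded_range.ediam_ne_top) _
          (.of_forall hmesh) (.of_forall hcover)
    _ ≤ liminf (fun _ : ℕ => ediam (range π) ^ (α : ℝ)) atTop :=
        liminf_le_liminf (.of_forall (hπ.sum_ediam_cylinder_rpow_le hf hα))
    _ = ediam (range π) ^ (α : ℝ) := liminf_const _

theorem dimH_range_le (hπ : IsCodingMap f π) (hf : ∀ i, LipschitzWith (r i) (f i))
    (hr : ∀ i, r i < 1) {α : ℝ≥0} (hα : ∑ i, r i ^ (α : ℝ) ≤ 1) : dimH (range π) ≤ α := by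
  borelize X
  exact dimH_le_of_hausdorffMeasure_ne_top <| ne_top_of_le_ne_top
    (ENNReal.rpow_ne_top_of_nonneg α.coe_nonneg hπ.isBounded_range.ediam_ne_top)
    (hπ.hausdorffMeasure_range_le hf hr hα)

end UpperBound

section Comparison

variable {f : ι → X → X} {g : ι → Y → Y} {π : (ℕ → ι) → X}
  {σ : (ℕ → ι) → Y} {r : ι → ℝ≥0} {α δ : ℝ≥0}

theorem exists_edist_le_mul_rpow [PseudoMetricSpace X] [PseudoMetricSpace Y]
    (hπ : IsCodingMap f π)
    (hf : ∀ i x y, r i * edist x y ≤ edist (f i x) (f i y)) (hδ : δ ≠ 0)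
    (hsep : ∀ a b : ℕ → ι, a 0 ≠ b 0 → δ ≤ edist (π a) (π b)) (hσ : IsCodingMap g σ)
    (hg : ∀ i, LipschitzWith (r i ^ (α : ℝ)) (g i)) :
    ∃ C : ℝ≥0, ∀ a b, edist (σ a) (σ b) ≤ C * edist (π a) (π b) ^ (α : ℝ) := by
  have hδ' : (δ : ℝ≥0∞) ≠ 0 := ENNReal.coe_ne_zero.2 hδ
  lift ediam (range σ) to ℝ≥0 using hσ.isBounded_range.ediam_ne_top with D hD
  refine ⟨D * (δ ^ (α : ℝ))⁻¹, fun a b => ?_⟩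
  obtain rfl | hab := eq_or_ne a b
  · simp
  classical
  obtain ⟨n, hagree, hne⟩ : ∃ n, (∀ j < n, a j = b j) ∧ a n ≠ b n :=
    have hex := Function.ne_iff.1 hab
    ⟨Nat.find hex, fun j hj => not_not.1 (Nat.find_min hex hj), Nat.find_spec hex⟩
  have hprod : ((∏ j ∈ Finset.range n, r (a j) : ℝ≥0) : ℝ≥0∞) ≤ edist (π a) (π b) / δ := by
    refine (ENNReal.le_div_iff_mul_le (.inl hδ') (.inl ENNReal.coe_ne_top)).2 ?_
    refine le_trans ?_ (hπ.prod_mul_edist_le hf hagree)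
    gcongr
    exact hsep _ _ (by simpa using hne)
  calc edist (σ a) (σ b)
      ≤ ↑(∏ j ∈ Finset.range n, r (a j) ^ (α : ℝ)) * D := hD ▸ hσ.edist_le hg hagree
    _ = ((∏ j ∈ Finset.range n, r (a j) : ℝ≥0) : ℝ≥0∞) ^ (α : ℝ) * D := by
        rw [NNReal.finsetProd_rpow, ENNReal.coe_rpow_of_nonneg _ α.coe_nonneg]
    _ ≤ (edist (π a) (π b) / δ) ^ (α : ℝ) * D := by gcongr
    _ = ↑(D * (δ ^ (α : ℝ))⁻¹) * edist (π a) (π b) ^ (α : ℝ) := by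
        rw [ENNReal.div_rpow_of_nonneg _ _ α.coe_nonneg, ENNReal.coe_mul,
          ENNReal.coe_inv (by simp [hδ]), ENNReal.coe_rpow_of_nonneg _ α.coe_nonneg,
          div_eq_mul_inv]
        ring

theorem dimH_range_le_div [MetricSpace X] [MetricSpace Y] (hπ : IsCodingMap f π)
    (hf : ∀ i x y, r i * edist x y ≤ edist (f i x) (f i y)) (hδ : δ ≠ 0)
    (hsep : ∀ a b : ℕ → ι, a 0 ≠ b 0 → δ ≤ edist (π a) (π b)) (hσ : IsCodingMap g σ)
    (hα : 0 < α) (hg : ∀ i, LipschitzWith (r i ^ (α : ℝ)) (g i)) :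
    dimH (range σ) ≤ dimH (range π) / α := by
  obtain ⟨C, hC⟩ := hπ.exists_edist_le_mul_rpow hf hδ hsep hσ hg
  have hfactor : σ.FactorsThrough π := fun a b hab => edist_le_zero.1 <| by
    simpa only [hab, edist_self, ENNReal.zero_rpow_of_pos (NNReal.coe_pos.2 hα), mul_zero]
      using hC a b
  obtain _ | ⟨⟨a₀⟩⟩ := isEmpty_or_nonempty (ℕ → ι)
  · simp [range_eq_empty]
  let h : X → Y := Function.extend π σ fun _ => σ a₀
  have hh (a : ℕ → ι) : h (π a) = σ a := hfactor.extend_apply _ a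
  have hholder : HolderOnWith C α h (range π) := by
    rintro _ ⟨a, rfl⟩ _ ⟨b, rfl⟩
    simpa only [hh] using hC a b
  have himage : h '' range π = range σ := by
    rw [← range_comp]
    exact congrArg range (funext hh)
  exact himage ▸ hholder.dimH_image_le hα

end Comparison

end IsCodingMap

theorem exists_pos_forall_le_edist [Finite ι] [EMetricSpace X] {K : ι → Set X}
    (hK : ∀ i, IsCompact (K i)) (hdisj : Pairwise fun i j => Disjoint (K i) (K j)) :
    ∃ δ : ℝ≥0, δ ≠ 0 ∧ ∀ i j, i ≠ j → ∀ x ∈ K i, ∀ y ∈ K j, δ ≤ edist x y := by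
  have hpair (q : ι × ι) : ∃ δ : ℝ≥0, 0 < δ ∧
      (q.1 ≠ q.2 → ∀ x ∈ K q.1, ∀ y ∈ K q.2, δ ≤ edist x y) := by
    by_cases hq : q.1 = q.2
    · exact ⟨1, one_pos, fun h => (h hq).elim⟩
    · obtain ⟨δ, hδ, h⟩ :=
        exists_pos_forall_lt_edist (hK q.1) (hK q.2).isClosed (hdisj hq)
      exact ⟨δ, hδ, fun _ x hx y hy => (h x hx y hy).le⟩
  choose δ hδ h using hpair
  have hsmall : ∀ᶠ ε : ℝ≥0 in 𝓝[>] 0, ∀ q, ε < δ q :=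
    eventually_all.2 fun q => (eventually_lt_nhds (hδ q)).filter_mono nhdsWithin_le_nhds
  obtain ⟨ε, hε, hε₀⟩ := (hsmall.and self_mem_nhdsWithin).exists
  exact ⟨ε, ne_of_gt hε₀, fun i j hij x hx y hy =>
    (ENNReal.coe_le_coe.2 (hε (i, j)).le).trans (h (i, j) hij x hx y hy)⟩

end CodingMap

section PRepresentation

open Finset

variable {s : ℕ} {p : Fin s → ℝ}

theorem pBeta_nonneg (hp : ∀ i, 0 ≤ p i) (k : Fin s) : 0 ≤ pBeta p k :=
  sum_nonneg fun i _ => hp i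

theorem pBeta_add_eq_sum_Iic (p : Fin s → ℝ) (k : Fin s) : pBeta p k + p k = ∑ i ∈ Iic k, p i :=
  sum_Iio_add_eq_sum_Iic k

theorem pBeta_add_le_pBeta (hp : ∀ i, 0 ≤ p i) {i j : Fin s} (hij : i < j) :
    pBeta p i + p i ≤ pBeta p j := by
  rw [pBeta_add_eq_sum_Iic]
  exact sum_le_sum_of_subset_of_nonneg
    (fun k hk => mem_Iio.2 ((mem_Iic.1 hk).trans_lt hij)) fun k _ _ => hp k

theorem pBeta_add_le_one (hp : ∀ i, 0 ≤ p i) (hsum : ∑ i, p i = 1) (k : Fin s) :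
    pBeta p k + p k ≤ 1 := by
  rw [pBeta_add_eq_sum_Iic, ← hsum]
  exact sum_le_univ_sum_of_nonneg hp

theorem pBeta_pos (hpos : ∀ i, 0 < p i) {k : Fin s} (hk : (k : ℕ) ≠ 0) : 0 < pBeta p k :=
  sum_pos (fun i _ => hpos i) ⟨⟨0, k.pos⟩, mem_Iio.2 (Fin.lt_def.2 (Nat.pos_of_ne_zero hk))⟩

/-- The affine map `x ↦ β_k + p_k x` which prepends the digit `k` to a P-representation. -/
noncomputable def digitMap (p : Fin s → ℝ) (k : Fin s) (x : ℝ) : ℝ :=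
  pBeta p k + p k * x

theorem dist_digitMap (hp : ∀ i, 0 ≤ p i) (k : Fin s) (x y : ℝ) :
    dist (digitMap p k x) (digitMap p k y) = p k * dist x y := by
  rw [digitMap, digitMap, dist_add_left, Real.dist_eq, ← mul_sub, abs_mul, abs_of_nonneg (hp k),
    Real.dist_eq]

theorem exists_pBeta_le_and_le_pBeta_add (hsum : ∑ i, p i = 1) {t : ℝ} (ht : t ∈ Set.Icc 0 1) :
    ∃ k, pBeta p k ≤ t ∧ t ≤ pBeta p k + p k := by
  have : NeZero s := ⟨fun h => by subst h; simp at hsum⟩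
  obtain ⟨k, hk, hmax⟩ := exists_max_image {k | pBeta p k ≤ t} id
    ⟨⊥, (mem_filter_univ _).2 (by simpa only [pBeta, Iio_bot, sum_empty] using ht.1)⟩
  rw [mem_filter_univ] at hk
  refine ⟨k, hk, le_of_not_gt fun hlt => ?_⟩
  rw [pBeta_add_eq_sum_Iic] at hlt
  have hk_max : ¬IsMax k := fun h => by
    rw [show Iic k = univ from eq_univ_of_forall fun i => mem_Iic.2 (h.isTop i), hsum] at hlt
    exact hlt.not_ge ht.2
  have hsucc : pBeta p (Order.succ k) ≤ t := by
    rw [pBeta, Iio_succ_eq_Iic_of_not_isMax hk_max]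
    exact hlt.le
  exact hk_max (Order.max_of_succ_le (hmax _ ((mem_filter_univ _).2 hsucc)))

theorem Icc_subset_iUnion_digitMap_image_Icc (hpos : ∀ i, 0 < p i) (hsum : ∑ i, p i = 1) :
    Set.Icc 0 1 ⊆ ⋃ k, digitMap p k '' Set.Icc 0 1 := by
  intro t ht
  obtain ⟨k, hk, hk'⟩ := exists_pBeta_le_and_le_pBeta_add hsum ht
  refine Set.mem_iUnion.2 ⟨k, (t - pBeta p k) / p k, ⟨div_nonneg (sub_nonneg.2 hk) (hpos k).le,
    (div_le_one (hpos k)).2 (sub_le_iff_le_add'.2 hk')⟩, ?_⟩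
  rw [digitMap, mul_div_cancel₀ _ (hpos k).ne', add_sub_cancel]

/-- The number with the P-representation `d` (the junk value `0` if the series diverges). -/
noncomputable def pSeries (p : Fin s → ℝ) (d : ℕ → Fin s) : ℝ :=
  ∑' n, pBeta p (d n) * ∏ j ∈ range n, p (d j)

theorem sum_range_add_prod_range_le_one (hp : ∀ i, 0 ≤ p i) (hsum : ∑ i, p i = 1)
    (d : ℕ → Fin s) (N : ℕ) :
    ∑ n ∈ range N, pBeta p (d n) * ∏ j ∈ range n, p (d j) + ∏ j ∈ range N, p (d j) ≤ 1 := by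
  induction N with
  | zero => simp
  | succ N ih =>
    have hprod : 0 ≤ ∏ j ∈ range N, p (d j) := prod_nonneg fun j _ => hp _
    rw [sum_range_succ, prod_range_succ]
    nlinarith [pBeta_add_le_one hp hsum (d N)]

theorem isPRepresentation_pSeries (hp : ∀ i, 0 ≤ p i) (hsum : ∑ i, p i = 1) (d : ℕ → Fin s) :
    IsPRepresentation p d (pSeries p d) := by
  have hprod (n : ℕ) : 0 ≤ ∏ j ∈ range n, p (d j) := prod_nonneg fun j _ => hp _
  refine Summable.hasSum <| summable_of_sum_range_le (c := 1)
    (fun n => mul_nonneg (pBeta_nonneg hp _) (hprod n)) fun N => ?_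
  linarith [hprod N, sum_range_add_prod_range_le_one hp hsum d N]

theorem isPRepresentation_iff_pSeries_eq (hp : ∀ i, 0 ≤ p i) (hsum : ∑ i, p i = 1)
    {d : ℕ → Fin s} {x : ℝ} : IsPRepresentation p d x ↔ pSeries p d = x :=
  (isPRepresentation_pSeries hp hsum d).summable.hasSum_iff

theorem pSeries_mem_Icc (hp : ∀ i, 0 ≤ p i) (hsum : ∑ i, p i = 1) (d : ℕ → Fin s) :
    pSeries p d ∈ Set.Icc 0 1 := by
  have hprod (n : ℕ) : 0 ≤ ∏ j ∈ range n, p (d j) := prod_nonneg fun j _ => hp _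
  have hnonneg (n : ℕ) := mul_nonneg (pBeta_nonneg hp (d n)) (hprod n)
  refine ⟨tsum_nonneg hnonneg, Real.tsum_le_of_sum_range_le hnonneg fun N => ?_⟩
  linarith [hprod N, sum_range_add_prod_range_le_one hp hsum d N]

theorem pSeries_eq_digitMap (hp : ∀ i, 0 ≤ p i) (hsum : ∑ i, p i = 1) (d : ℕ → Fin s) :
    pSeries p d = digitMap p (d 0) (pSeries p fun n => d (n + 1)) := by
  rw [pSeries, (isPRepresentation_pSeries hp hsum d).summable.tsum_eq_zero_add, digitMap, pSeries,
    ← tsum_mul_left]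
  simp only [prod_range_succ', range_zero, prod_empty, mul_one]
  congr 1
  exact tsum_congr fun n => by ring

theorem isCodingMap_pSeries (hp : ∀ i, 0 ≤ p i) (hsum : ∑ i, p i = 1) :
    IsCodingMap (digitMap p) (pSeries p) where
  isBounded_range := (Metric.isBounded_Icc 0 1).subset <| Set.range_subset_iff.2 <|
    pSeries_mem_Icc hp hsum
  apply_eq := pSeries_eq_digitMap hp hsum

theorem Icc_subset_range_pSeries (hpos : ∀ i, 0 < p i) (hlt : ∀ i, p i < 1)
    (hsum : ∑ i, p i = 1) : Set.Icc 0 1 ⊆ Set.range (pSeries p) := by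
  have hp (i : Fin s) := (hpos i).le
  obtain ⟨ρ, hρ, hlip⟩ := exists_lipschitzWith_lt_one hlt fun i x y => (dist_digitMap hp i x y).le
  exact (isCodingMap_pSeries hp hsum).subset_range hlip hρ (Metric.isBounded_Icc 0 1)
    (Icc_subset_iUnion_digitMap_image_Icc hpos hsum)

end PRepresentation

section SelfSimilarDimension

open Set MeasureTheory
open scoped NNReal ENNReal

variable {ι X : Type*} [Fintype ι]

theorem IsSelfSimilarSet.dimH_le [MetricSpace X] {r : ι → ℝ≥0} {S : Set X}
    (hS : IsSelfSimilarSet (fun i => r i) S) {α : ℝ≥0} (hα : ∑ i, r i ^ (α : ℝ) ≤ 1) :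
    dimH S ≤ α := by
  obtain ⟨f, π, hf, hπ, rfl, -⟩ := hS.exists_isCodingMap
  exact hπ.dimH_range_le (fun i => LipschitzWith.of_dist_le_mul fun x y => (hf i x y).le)
    (fun i => (hS.2.2.1 i).2) hα

theorem exists_isCodingMap_Icc_subset_range {w : ι → ℝ} (hpos : ∀ i, 0 < w i)
    (hlt : ∀ i, w i < 1) (hsum : ∑ i, w i = 1) :
    ∃ (g : ι → ℝ → ℝ) (σ : (ℕ → ι) → ℝ), (∀ i x y, dist (g i x) (g i y) = w i * dist x y) ∧
      IsCodingMap g σ ∧ Icc 0 1 ⊆ range σ := by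
  let e := Fintype.equivFin ι
  have hsum' : ∑ k, (w ∘ e.symm) k = 1 := (e.symm.sum_comp w).trans hsum
  have hnonneg (k) : 0 ≤ (w ∘ e.symm) k := (hpos _).le
  have hcoding := isCodingMap_pSeries hnonneg hsum'
  refine ⟨fun i => digitMap (w ∘ e.symm) (e i), fun a => pSeries (w ∘ e.symm) (e ∘ a),
    fun i x y => ?_, ⟨hcoding.isBounded_range.subset (range_subset_iff.2 fun a => ⟨e ∘ a, rfl⟩),
      fun a => hcoding.apply_eq _⟩, fun x hx => ?_⟩
  · simpa only [Function.comp_apply, e.symm_apply_apply] using dist_digitMap hnonneg (e i) x y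
  · obtain ⟨d, rfl⟩ := Icc_subset_range_pSeries (fun k => hpos (e.symm k)) (fun k => hlt _) hsum' hx
    exact ⟨e.symm ∘ d, by simp [Function.comp_def]⟩

theorem IsSelfSimilarSet.le_dimH [MetricSpace X] {r : ι → ℝ≥0} {S : Set X}
    (hS : IsSelfSimilarSet (fun i => r i) S) {α : ℝ≥0} (hα : ∑ i, r i ^ (α : ℝ) = 1) :
    α ≤ dimH S := by
  obtain rfl | hα₀ := eq_or_ne α 0
  · simp
  have hα₀' : 0 < (α : ℝ) := NNReal.coe_pos.2 hα₀.bot_lt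
  obtain ⟨f, π, hf, hπ, rfl, hdisj⟩ := hS.exists_isCodingMap
  obtain ⟨-, hcpt, hr, -⟩ := hS
  have hfcont (i : ι) : Continuous (f i) :=
    (LipschitzWith.of_dist_le_mul (K := r i) fun x y => (hf i x y).le).continuous
  obtain ⟨δ, hδ, hsep⟩ := exists_pos_forall_le_edist (fun i => hcpt.image (hfcont i)) hdisj
  have hmem (a : ℕ → ι) : π a ∈ f (a 0) '' range π := ⟨_, mem_range_self _, (hπ.apply_eq a).symm⟩
  obtain ⟨g, σ, hg, hσ, hIcc⟩ := exists_isCodingMap_Icc_subset_range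
    (w := fun i => (r i : ℝ) ^ (α : ℝ)) (fun i => Real.rpow_pos_of_pos (hr i).1 _)
    (fun i => Real.rpow_lt_one (hr i).1.le (hr i).2 hα₀') (mod_cast hα)
  have hle : dimH (range σ) ≤ dimH (range π) / α := by
    refine hπ.dimH_range_le_div (fun i x y => ?_) hδ
      (fun a b hab => hsep _ _ hab _ (hmem a) _ (hmem b)) hσ hα₀.bot_lt
      fun i => LipschitzWith.of_dist_le_mul fun x y => (hg i x y).le
    rw [edist_nndist, edist_nndist, ← ENNReal.coe_mul, ENNReal.coe_le_coe]
    exact (hf i x y).ge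
  have hone : 1 ≤ dimH (range σ) := by
    have hinterval : dimH (Icc (0 : ℝ) 1) = 1 := by
      simpa using Real.dimH_of_nonempty_interior (s := Icc (0 : ℝ) 1) (by simp)
    exact hinterval ▸ dimH_mono hIcc
  simpa using (ENNReal.le_div_iff_mul_le (.inl (by simpa)) (.inl (by simp))).1 (hone.trans hle)

theorem IsSelfSimilarSet.dimH_eq [MetricSpace X] {r : ι → ℝ} {S : Set X}
    (hS : IsSelfSimilarSet r S) {α : ℝ} (hα : 0 ≤ α) (hsum : ∑ i, r i ^ α = 1) :
    dimH S = ENNReal.ofReal α := by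
  lift r to ι → ℝ≥0 using fun i => (hS.2.2.1 i).1.le
  lift α to ℝ≥0 using hα
  rw [ENNReal.ofReal_coe_nnreal]
  beta_reduce at hsum
  norm_cast at hsum
  exact (hS.dimH_le hsum.le).antisymm (hS.le_dimH hsum)

theorem strictAnti_sum_rpow [Nonempty ι] {r : ι → ℝ} (hr₀ : ∀ i, 0 < r i) (hr₁ : ∀ i, r i < 1) :
    StrictAnti fun t : ℝ => ∑ i, r i ^ t := fun _ _ h =>
  Finset.sum_lt_sum_of_nonempty Finset.univ_nonempty fun i _ =>
    Real.rpow_lt_rpow_of_exponent_gt (hr₀ i) (hr₁ i) h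

theorem exists_sum_rpow_eq_one [Nonempty ι] {r : ι → ℝ} (hr₀ : ∀ i, 0 < r i)
    (hsum : ∑ i, r i < 1) : ∃ α : ℝ, 0 ≤ α ∧ α < 1 ∧ ∑ i, r i ^ α = 1 := by
  have hcont : Continuous fun t : ℝ => ∑ i, r i ^ t :=
    continuous_finsetSum _ fun i _ => Real.continuous_const_rpow (hr₀ i).ne'
  have hzero : 1 ≤ ∑ i, r i ^ (0 : ℝ) := by
    simpa using Nat.one_le_iff_ne_zero.2 Fintype.card_ne_zero
  obtain ⟨α, hα, h⟩ := intermediate_value_Ico' zero_le_one hcont.continuousOn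
    (show (1 : ℝ) ∈ Ioc _ _ from ⟨by simpa using hsum, hzero⟩)
  exact ⟨α, hα.1, hα.2, h⟩

end SelfSimilarDimension

theorem isTotallyDisconnected_of_dimH_lt_one {S : Set ℝ} (hS : dimH S < 1) :
    IsTotallyDisconnected S :=
  isTotallyDisconnected_iff_lt.2 fun _ _ _ _ h =>
    (dense_compl_of_dimH_lt_finrank (by simpa using hS)).exists_between h

section Blocks

open Set

variable {s : ℕ} {p : Fin s → ℝ} {u : Fin s}

theorem digitMap_lt_digitMap (hpos : ∀ i, 0 < p i) {i j : Fin s} (hij : i < j) {x y : ℝ}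
    (hx : x ≤ 1) (hy : 0 < y) : digitMap p i x < digitMap p j y :=
  calc pBeta p i + p i * x
      ≤ pBeta p i + p i := by gcongr; exact mul_le_of_le_one_right (hpos i).le hx
    _ ≤ pBeta p j := pBeta_add_le_pBeta (fun k => (hpos k).le) hij
    _ < pBeta p j + p j * y := lt_add_of_pos_right _ (mul_pos (hpos j) hy)

theorem digitMap_ne_digitMap (hpos : ∀ i, 0 < p i) {i j : Fin s} (hij : i ≠ j) {x y : ℝ}
    (hx : x ∈ Ioc 0 1) (hy : y ∈ Ioc 0 1) : digitMap p i x ≠ digitMap p j y :=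
  hij.lt_or_gt.elim (fun h => (digitMap_lt_digitMap hpos h hx.2 hy.1).ne)
    fun h => (digitMap_lt_digitMap hpos h hy.2 hx.1).ne'

theorem digitMap_injective {i : Fin s} (hi : p i ≠ 0) : Function.Injective (digitMap p i) :=
  (add_right_injective _).comp (mul_right_injective₀ hi)

theorem digitMap_le_one (hp : ∀ i, 0 ≤ p i) (hsum : ∑ i, p i = 1) (i : Fin s) {x : ℝ}
    (hx : x ≤ 1) : digitMap p i x ≤ 1 :=
  calc pBeta p i + p i * x
      ≤ pBeta p i + p i := by gcongr; exact mul_le_of_le_one_right (hp i) hx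
    _ ≤ 1 := pBeta_add_le_one hp hsum i

theorem mapsTo_digitMap_Ioc (hpos : ∀ i, 0 < p i) (hsum : ∑ i, p i = 1) (i : Fin s) :
    MapsTo (digitMap p i) (Ioc 0 1) (Ioc 0 1) := fun _ hx =>
  ⟨add_pos_of_nonneg_of_pos (pBeta_nonneg (fun k => (hpos k).le) i) (mul_pos (hpos i) hx.1),
    digitMap_le_one (fun k => (hpos k).le) hsum i hx.2⟩

theorem mapsTo_digitMap_Icc_Ioc (hpos : ∀ i, 0 < p i) (hsum : ∑ i, p i = 1) {i : Fin s}
    (hi : (i : ℕ) ≠ 0) : MapsTo (digitMap p i) (Icc 0 1) (Ioc 0 1) := fun _ hx =>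
  ⟨add_pos_of_pos_of_nonneg (pBeta_pos hpos hi) (mul_nonneg (hpos i).le hx.1),
    digitMap_le_one (fun k => (hpos k).le) hsum i hx.2⟩

/-- The affine map which prepends the block `u … u i`, with `i - 1` digits `u`, to a
P-representation. -/
noncomputable def blockMap (p : Fin s → ℝ) (u i : Fin s) (x : ℝ) : ℝ :=
  (digitMap p u)^[(i : ℕ) - 1] (digitMap p i x)

/-- The contraction ratio of `blockMap p u i`. -/
noncomputable def blockRatio (p : Fin s → ℝ) (u i : Fin s) : ℝ :=
  p i * p u ^ ((i : ℕ) - 1)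

theorem blockRatio_pos (hpos : ∀ i, 0 < p i) (u i : Fin s) : 0 < blockRatio p u i :=
  mul_pos (hpos i) (pow_pos (hpos u) _)

theorem sum_blockRatio_lt_one (hpos : ∀ i, 0 < p i) (hsum : ∑ i, p i = 1) (u : Fin s) :
    ∑ i ∈ admissibleDigits u, blockRatio p u i < 1 := by
  have hu : p u ≤ 1 :=
    hsum ▸ Finset.single_le_sum (fun i _ => (hpos i).le) (Finset.mem_univ u)
  calc ∑ i ∈ admissibleDigits u, blockRatio p u i
      ≤ ∑ i ∈ admissibleDigits u, p i := Finset.sum_le_sum fun i _ =>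
        mul_le_of_le_one_right (hpos i).le (pow_le_one₀ (hpos u).le hu)
    _ < ∑ i, p i := Finset.sum_lt_sum_of_subset (Finset.subset_univ _) (Finset.mem_univ u)
        (by simp [admissibleDigits]) (hpos u) fun i _ _ => (hpos i).le
    _ = 1 := hsum

theorem blockRatio_lt_one (hpos : ∀ i, 0 < p i) (hsum : ∑ i, p i = 1) {i : Fin s}
    (hi : i ∈ admissibleDigits u) : blockRatio p u i < 1 :=
  (Finset.single_le_sum (fun j _ => (blockRatio_pos hpos u j).le) hi).trans_lt
    (sum_blockRatio_lt_one hpos hsum u)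

theorem dist_blockMap (hp : ∀ i, 0 ≤ p i) (u i : Fin s) (x y : ℝ) :
    dist (blockMap p u i x) (blockMap p u i y) = blockRatio p u i * dist x y := by
  have hiterate (n : ℕ) (x y : ℝ) :
      dist ((digitMap p u)^[n] x) ((digitMap p u)^[n] y) = p u ^ n * dist x y := by
    induction n with
    | zero => simp
    | succ n ih =>
      rw [Function.iterate_succ_apply', Function.iterate_succ_apply', dist_digitMap hp, ih]
      ring
  rw [blockMap, blockMap, hiterate, dist_digitMap hp, blockRatio]
  ring

theorem mapsTo_blockMap (hpos : ∀ i, 0 < p i) (hsum : ∑ i, p i = 1) {i : Fin s}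
    (hi : (i : ℕ) ≠ 0) : MapsTo (blockMap p u i) (Icc 0 1) (Ioc 0 1) :=
  ((mapsTo_digitMap_Ioc hpos hsum u).iterate _).comp (mapsTo_digitMap_Icc_Ioc hpos hsum hi)

theorem blockMap_ne_blockMap_of_lt (hpos : ∀ i, 0 < p i) (hsum : ∑ i, p i = 1) {i j : Fin s}
    (hi : i ∈ admissibleDigits u) (hij : i < j) {x y : ℝ} (hx : x ∈ Ioc 0 1) (hy : y ∈ Ioc 0 1) :
    blockMap p u i x ≠ blockMap p u j y := by
  obtain ⟨hi₀, hiu⟩ := (Finset.mem_filter_univ _).1 hi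
  obtain ⟨m, hm⟩ : ∃ m, (j : ℕ) - 1 = (i - 1) + (m + 1) := ⟨j - i - 1, by omega⟩
  have htail : (digitMap p u)^[m] (digitMap p j y) ∈ Ioc 0 1 :=
    (mapsTo_digitMap_Ioc hpos hsum u).iterate m (mapsTo_digitMap_Ioc hpos hsum j hy)
  rw [blockMap, blockMap, hm, Function.iterate_add_apply, Function.iterate_succ_apply']
  exact ((digitMap_injective (hpos u).ne').iterate _).ne (digitMap_ne_digitMap hpos hiu hx htail)

theorem blockMap_ne_blockMap (hpos : ∀ i, 0 < p i) (hsum : ∑ i, p i = 1) {i j : Fin s}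
    (hi : i ∈ admissibleDigits u) (hj : j ∈ admissibleDigits u) (hij : i ≠ j) {x y : ℝ}
    (hx : x ∈ Ioc 0 1) (hy : y ∈ Ioc 0 1) : blockMap p u i x ≠ blockMap p u j y :=
  hij.lt_or_gt.elim (fun h => blockMap_ne_blockMap_of_lt hpos hsum hi h hx hy)
    fun h => (blockMap_ne_blockMap_of_lt hpos hsum hj h hy hx).symm

theorem blockStart_succ (a : ℕ → Fin s) (n : ℕ) : blockStart a (n + 1) = blockStart a n + a n :=
  Finset.sum_range_succ _ _

theorem exists_isBlockSequence (u : Fin s) {a : ℕ → Fin s} (ha : ∀ n, (a n : ℕ) ≠ 0) :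
    ∃ d, IsBlockSequence u a d := by
  obtain ⟨last, hlast⟩ : ∃ last : ℕ → ℕ, ∀ n, last n = blockStart a n + (a n - 1) :=
    ⟨_, fun _ => rfl⟩
  have hlast_succ (n : ℕ) : blockStart a (n + 1) = last n + 1 := by
    rw [blockStart_succ, hlast, add_assoc, Nat.sub_add_cancel (Nat.pos_of_ne_zero (ha n))]
  have hmono : StrictMono last := strictMono_nat_of_lt_succ fun n => by
    rw [hlast (n + 1), hlast_succ]
    omega
  refine ⟨Function.extend last a fun _ => u, fun n =>
    ⟨fun j hj => Function.extend_apply' _ _ _ ?_, hlast n ▸ hmono.injective.extend_apply ..⟩⟩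
  rintro ⟨m, hm⟩
  have hmn : m < n := hmono.lt_iff_lt.1 (by rw [hm, hlast]; omega)
  have hle : blockStart a (m + 1) ≤ blockStart a n :=
    Finset.sum_le_sum_of_subset (Finset.range_mono hmn)
  rw [hlast_succ] at hle
  omega

theorem IsBlockSequence.pSeries_shift_eq_blockMap (hp : ∀ i, 0 ≤ p i) (hsum : ∑ i, p i = 1)
    {a d : ℕ → Fin s} (hd : IsBlockSequence u a d) {n : ℕ} (ha : (a n : ℕ) ≠ 0) :
    pSeries p (fun k => d (k + blockStart a n)) =
      blockMap p u (a n) (pSeries p fun k => d (k + blockStart a (n + 1))) := by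
  have hcoding := isCodingMap_pSeries hp hsum
  let e (k : ℕ) : Fin s := d (k + blockStart a n)
  have hlast : e (a n - 1) = a n := (congrArg d (add_comm _ _)).trans (hd n).2
  calc pSeries p e
      = (digitMap p u)^[a n - 1] (pSeries p fun k => e (k + (a n - 1))) :=
        hcoding.apply_eq_iterate fun j hj => (congrArg d (add_comm _ _)).trans ((hd n).1 j hj)
    _ = blockMap p u (a n) (pSeries p fun k => e (k + (a n - 1 + 1))) := by
        rw [hcoding.apply_shift, hlast, blockMap]
    _ = blockMap p u (a n) (pSeries p fun k => d (k + blockStart a (n + 1))) := by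
        simp only [e, Nat.sub_add_cancel (Nat.pos_of_ne_zero ha), blockStart_succ, add_assoc,
          add_comm (blockStart a n)]

theorem IsBlockSequence.pSeries_eq (hpos : ∀ i, 0 < p i) (hsum : ∑ i, p i = 1)
    {π : (ℕ → admissibleDigits u) → ℝ}
    (hπ : IsCodingMap (fun i : admissibleDigits u => blockMap p u i) π)
    {a : ℕ → admissibleDigits u} {d : ℕ → Fin s} (hd : IsBlockSequence u (fun n => a n) d) :
    π a = pSeries p d := by
  have hp (i : Fin s) := (hpos i).le
  obtain ⟨ρ, hρ, hlip⟩ := exists_lipschitzWith_lt_one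
    (fun i : admissibleDigits u => blockRatio_lt_one hpos hsum i.2)
    fun i x y => (dist_blockMap hp u i x y).le
  exact hπ.apply_eq_of_orbit hlip hρ (Metric.isBounded_Icc 0 1)
    (y := fun n => pSeries p fun k => d (k + blockStart (fun n => (a n : Fin s)) n))
    (fun n => pSeries_mem_Icc hp hsum _)
    fun n => hd.pSeries_shift_eq_blockMap hp hsum ((Finset.mem_filter_univ _).1 (a n).2).1

theorem exists_isCodingMap_blockMap (hpos : ∀ i, 0 < p i) (hsum : ∑ i, p i = 1) (u : Fin s) :
    ∃ π : (ℕ → admissibleDigits u) → ℝ,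
      IsCodingMap (fun i : admissibleDigits u => blockMap p u i) π ∧ range π = setS p u := by
  have hp (i : Fin s) := (hpos i).le
  obtain ⟨ρ, hρ, hlip⟩ := exists_lipschitzWith_lt_one
    (fun i : admissibleDigits u => blockRatio_lt_one hpos hsum i.2)
    fun i x y => (dist_blockMap hp u i x y).le
  obtain ⟨π, hπ⟩ := exists_isCodingMap_of_lipschitzWith hlip hρ
  refine ⟨π, hπ, Subset.antisymm ?_ ?_⟩
  · rintro _ ⟨a, rfl⟩
    obtain ⟨d, hd⟩ := exists_isBlockSequence u fun n => ((Finset.mem_filter_univ _).1 (a n).2).1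
    exact ⟨fun n => a n, d, fun n => (a n).2, hd,
      (isPRepresentation_iff_pSeries_eq hp hsum).2 (hd.pSeries_eq hpos hsum hπ).symm⟩
  · rintro x ⟨a, d, ha, hd, hx⟩
    refine ⟨fun n => ⟨a n, ha n⟩, ?_⟩
    rw [← (isPRepresentation_iff_pSeries_eq hp hsum).1 hx]
    exact hd.pSeries_eq hpos hsum hπ

theorem setS_subset_Icc (hpos : ∀ i, 0 < p i) (hsum : ∑ i, p i = 1) : setS p u ⊆ Icc 0 1 := by
  have hp (i : Fin s) := (hpos i).le
  rintro x ⟨a, d, -, -, hx⟩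
  exact (isPRepresentation_iff_pSeries_eq hp hsum).1 hx ▸ pSeries_mem_Icc hp hsum d

theorem setS_subset_Ioc (hpos : ∀ i, 0 < p i) (hsum : ∑ i, p i = 1) : setS p u ⊆ Ioc 0 1 := by
  obtain ⟨π, hπ, hrange⟩ := exists_isCodingMap_blockMap hpos hsum u
  rw [← hrange, hπ.range_eq_iUnion, hrange]
  exact iUnion_subset fun i =>
    ((mapsTo_blockMap hpos hsum ((Finset.mem_filter_univ _).1 i.2).1).mono_left
      (setS_subset_Icc hpos hsum)).image_subset

theorem isSelfSimilarSet_setS (hpos : ∀ i, 0 < p i) (hsum : ∑ i, p i = 1)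
    (hu : (admissibleDigits u).Nonempty) :
    IsSelfSimilarSet (fun i : admissibleDigits u => blockRatio p u i) (setS p u) := by
  have := hu.to_subtype
  obtain ⟨π, hπ, hrange⟩ := exists_isCodingMap_blockMap hpos hsum u
  have hsub := hrange.trans_subset (setS_subset_Ioc hpos hsum)
  refine hrange ▸ hπ.isSelfSimilarSet_range (fun i => blockRatio_pos hpos u i)
    (fun i => blockRatio_lt_one hpos hsum i.2)
    (fun i => dist_blockMap (fun k => (hpos k).le) u i) fun i j hij => disjoint_left.2 ?_
  rintro _ ⟨x, hx, rfl⟩ ⟨y, hy, hxy⟩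
  exact blockMap_ne_blockMap hpos hsum i.2 j.2 (Subtype.coe_ne_coe.2 hij) (hsub hx) (hsub hy)
    hxy.symm

theorem le_card_admissibleDigits_add_two (u : Fin s) : s ≤ (admissibleDigits u).card + 2 := by
  have hsdiff : admissibleDigits u = Finset.univ \ {⟨0, u.pos⟩, u} := by
    ext i
    simp [admissibleDigits, Fin.ext_iff]
  calc s ≤ (admissibleDigits u).card + ({⟨0, u.pos⟩, u} : Finset (Fin s)).card := by
        rw [hsdiff, Finset.card_sdiff_add_card_eq_card (Finset.subset_univ _), Finset.card_fin]
    _ ≤ (admissibleDigits u).card + 2 := by gcongr; exact Finset.card_le_two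

theorem admissibleDigits_nonempty (hs : 2 < s) (u : Fin s) : (admissibleDigits u).Nonempty := by
  have := le_card_admissibleDigits_add_two u
  exact Finset.card_pos.1 (by omega)

theorem one_lt_card_admissibleDigits (hs : 2 < s) {u : Fin s} (hu : s = 3 → (u : ℕ) = 0) :
    1 < (admissibleDigits u).card := by
  obtain rfl | hs₃ := eq_or_ne s 3
  · obtain rfl : u = 0 := Fin.ext (hu rfl)
    decide
  · have := le_card_admissibleDigits_add_two u
    omega

end Blocks

theorem mainTheorem1 (s : ℕ) (hs : 2 < s) (p : Fin s → ℝ) (hpos : ∀ i, 0 < p i)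
    (hsum : ∑ i, p i = 1) (u : Fin s) :
    IsSelfSimilarSet
        (fun i : admissibleDigits u => p (i : Fin s) * p u ^ (((i : Fin s) : ℕ) - 1))
        (setS p u) ∧
    ((s = 3 → (u : ℕ) = 0) → IsFractalSubset (setS p u)) ∧
    ∃ α₀ : ℝ, 0 ≤ α₀ ∧ dimH (setS p u) = ENNReal.ofReal α₀ ∧
      ∑ i ∈ admissibleDigits u, (p i * p u ^ ((i : ℕ) - 1)) ^ α₀ = 1 ∧
      ∀ t : ℝ, ∑ i ∈ admissibleDigits u, (p i * p u ^ ((i : ℕ) - 1)) ^ t = 1 → t = α₀ := by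
  have hS := isSelfSimilarSet_setS hpos hsum (admissibleDigits_nonempty hs u)
  have : Nonempty (admissibleDigits u) := (admissibleDigits_nonempty hs u).to_subtype
  have hratio (i : admissibleDigits u) := hS.2.2.1 i
  have hlt : ∑ i : admissibleDigits u, blockRatio p u i < 1 :=
    (Finset.sum_coe_sort _ (blockRatio p u)).trans_lt (sum_blockRatio_lt_one hpos hsum u)
  obtain ⟨α, hα₀, hα₁, hα⟩ := exists_sum_rpow_eq_one (fun i => (hratio i).1) hlt
  have hdim : dimH (setS p u) = ENNReal.ofReal α := hS.dimH_eq hα₀ hα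
  have hsum_coe (t : ℝ) : ∑ i : admissibleDigits u, blockRatio p u i ^ t =
      ∑ i ∈ admissibleDigits u, blockRatio p u i ^ t := Finset.sum_coe_sort _ (blockRatio p u · ^ t)
  refine ⟨hS, fun hu => ⟨isTotallyDisconnected_of_dimH_lt_one ?_, ?_⟩, α, hα₀, hdim,
    (hsum_coe α).symm.trans hα, fun t ht => ?_⟩
  · rwa [hdim, ENNReal.ofReal_lt_one]
  · rw [hdim, ENNReal.ofReal_pos]
    refine hα₀.lt_of_ne' ?_
    rintro rfl
    exact (one_lt_card_admissibleDigits hs hu).ne' (by simpa using hα)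
  · exact (strictAnti_sum_rpow (fun i => (hratio i).1) fun i => (hratio i).2).injective
      (((hsum_coe t).trans ht).trans hα.symm)
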